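/- Let $\mathcal{X}$ be a finite set with at least two elements, and let $A\subseteq\mathcal{X}$ be non-empty, with complement $A^c$ and indicator functions $\mathbb{1}_A,\mathbb{1}_{A^c}$. Products, inequalities, infima, suprema and limits of functions $\mathcal{X}\to\mathbb{R}$ are taken pointwise. A *rate matrix* is a real matrix $Q=(Q(x,y))_{x,y\in\mathcal{X}}$ with $Q(x,y)\ge 0$ for $x\ne y$ and $\sum_{y}Q(x,y)=0$ for all $x$; it acts by $(Qf)(x)=\sum_y Q(x,y)f(y)$. Let $\mathcal{Q}$ be a non-empty, compact, convex set of rate matrices that has separately specified rows (if $R_x\in\mathcal{Q}$ for every $x\in\mathcal{X}$, then the matrix whose row $x$ is row $x$ of $R_x$, for every $x$, is in $\mathcal{Q}$). For $f:\mathcal{X}\to\mathbb{R}$ and $t\ge 0$ put $$\underline{Q}f=\inf_{Q\in\mathcal{Q}}Qf,\qquad \overline{Q}f=\sup_{Q\in\mathcal{Q}}Qf,$$ $$e^{\underline{Q}t}f=\lim_{n\to\infty}\bigl(I+\tfrac{t}{n}\underline{Q}\bigr)^n f,\qquad e^{\overline{Q}t}f=\lim_{n\to\infty}\bigl(I+\tfrac{t}{n}\overline{Q}\bigr)^n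 f$$ (these limits exist). Assume that 1. every state of $A$ is absorbing: $Q(x,x)=0$ for all $Q\in\mathcal{Q}$ and $x\in A$; 2. $A$ is lower reachable from $A^c$: $(e^{\underline{Q}t}\mathbb{1}_A)(x)>0$ for all $t>0$ and $x\in A^c$. For $\Delta>0$ let $\underline{h}_\Delta$ and $\overline{h}_\Delta$ be the minimal (i.e. pointwise least) non-negative solutions $h:\mathcal{X}\to\mathbb{R}$ of the non-linear systems $$h=\Delta\mathbb{1}_{A^c}+\mathbb{1}_{A^c}\,e^{\underline{Q}\Delta}h\qquad\text{and}\qquad h=\Delta\mathbb{1}_{A^c}+\mathbb{1}_{A^c}\,e^{\overline{Q}\Delta}h,$$ respectively, and for $Q\in\mathcal{Q}$ let $h^Q$ be the minimal non-negative solution $h:\mathcal{X}\to\mathbb{R}$ of the linear system $$\mathbb{1}_A h=\mathbb{1}_{A^c}+\mathbb{1}_{A^c}\,Qh .$$ Then all these minimal solutions exist, the functions $h^Q$, $Q\in\mathcal{Q}$, are uniformly bounded, and $$\lim_{\Delta\to0^+}\underline{h}_\Delta=\inf_{Q\in\mathcal{Q}}h^Q\qquad\text{and}\qquad\lim_{\Delta\to0^+}\overline{h}_\Delta=\sup_{Q\in\mathcal{Q}}h^Q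 .$$ -/

import Mathlib

open Filter Topology

/-- A rate matrix: non-negative off-diagonal entries and zero row sums. -/
def IsRateMatrix {X : Type*} [Fintype X] (Q : Matrix X X ℝ) : Prop :=
  (∀ x y, x ≠ y → 0 ≤ Q x y) ∧ ∀ x, ∑ y, Q x y = 0

/-- A set of matrices has separately specified rows if it is closed under
row-wise recombination: choosing the row `x` from the member `R x`, for every `x`,
gives a member again. -/
def SeparatelySpecifiedRows {X : Type*} (𝒬 : Set (Matrix X X ℝ)) : Prop :=
  ∀ R : X → Matrix X X ℝ, (∀ x, R x ∈ 𝒬) → Matrix.of (fun x y => R x x y) ∈ 𝒬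

/-- The lower rate operator of `𝒬`: the pointwise infimum of `Q f` over `Q ∈ 𝒬`. -/
noncomputable def lowerRate {X : Type*} [Fintype X] (𝒬 : Set (Matrix X X ℝ))
    (f : X → ℝ) : X → ℝ :=
  fun x => ⨅ Q : 𝒬, (Q : Matrix X X ℝ).mulVec f x

/-- The upper rate operator of `𝒬`: the pointwise supremum of `Q f` over `Q ∈ 𝒬`. -/
noncomputable def upperRate {X : Type*} [Fintype X] (𝒬 : Set (Matrix X X ℝ))
    (f : X → ℝ) : X → ℝ :=
  fun x => ⨆ Q : 𝒬, (Q : Matrix X X ℝ).mulVec f x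

/-- The value at `f` of `(I + (t / n) M) ^ n`, for a possibly non-linear operator `M`. -/
noncomputable def expApprox {X : Type*} (M : (X → ℝ) → (X → ℝ)) (t : ℝ) (n : ℕ)
    (f : X → ℝ) : X → ℝ :=
  (fun g => g + (t / n) • M g)^[n] f

/-- The operator exponential `e ^ (M t) = lim (I + (t / n) M) ^ n`, evaluated at `f`. -/
noncomputable def opExp {X : Type*} (M : (X → ℝ) → (X → ℝ)) (t : ℝ) (f : X → ℝ) : X → ℝ :=
  limUnder atTop (fun n : ℕ => expApprox M t n f)

/-- The non-negative solutions of `h = Δ 1_{Aᶜ} + 1_{Aᶜ} T h`. -/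
def discreteSolutions {X : Type*} (A : Set X) (Δ : ℝ) (T : (X → ℝ) → (X → ℝ)) :
    Set (X → ℝ) :=
  {h | 0 ≤ h ∧ h = Δ • Aᶜ.indicator 1 + Aᶜ.indicator 1 * T h}

/-- The non-negative solutions of `1_A h = 1_{Aᶜ} + 1_{Aᶜ} Q h`. -/
def continuousSolutions {X : Type*} [Fintype X] (A : Set X) (Q : Matrix X X ℝ) :
    Set (X → ℝ) :=
  {h | 0 ≤ h ∧ A.indicator 1 * h = Aᶜ.indicator 1 + Aᶜ.indicator 1 * Q.mulVec h}

/-! Discrete and continuous hitting times are fixed points of one map, `hitStep`: in discrete time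
with the exponential as transition operator, in continuous time with a small Euler step `I + s M`
(`discreteSolutions_eulerStep`). The comparison principle `IsTransitionOperator.le_of_hitStep` puts
every subsolution below every non-negative supersolution, so solutions are unique and ordered like
their operators.

Existence follows from bounded monotone iteration. By the duality `f ↦ 1 - f`, lower reachability of
`A` says that the upper operator loses mass from `Aᶜ`; this bounds its iterates, and hence those of
every smaller operator.

For convergence, let `g` solve the problem of a rate operator `M`. Since `e^{MΔ} g = g + Δ M g +
O(Δ²)` and `M g = -1` off `A`, the multiples `(1 - CΔ) g` and `(1 + 2CΔ) g` are a sub- and a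
supersolution of the discrete problem and squeeze its solution to `g`.

Finally, compactness and separately specified rows give one `Q ∈ 𝒬` attaining the lower (upper) rate
at `g` in all states. Thus `g` is `h^Q`, and by comparison it is the infimum (supremum). -/

/-- A possibly non-linear operator that is monotone, positively homogeneous and
commutes with the addition of constants. -/
structure IsTransitionOperator {X : Type*} (P : (X → ℝ) → (X → ℝ)) : Prop where
  mono : Monotone P
  map_smul : ∀ (c : ℝ) (f : X → ℝ), 0 ≤ c → P (c • f) = c • P f
  map_add_const : ∀ (f : X → ℝ) (c : ℝ), P (fun x => f x + c) = fun x => P f x + c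

/-- A possibly non-linear operator that is positively homogeneous, insensitive to
constants and such that `M + L` is monotone. -/
structure IsRateOperator {X : Type*} (M : (X → ℝ) → (X → ℝ)) (L : ℝ) : Prop where
  nonneg : 0 ≤ L
  mono : ∀ f g : X → ℝ, f ≤ g → ∀ x, M f x + L * f x ≤ M g x + L * g x
  map_smul : ∀ (c : ℝ) (f : X → ℝ), 0 ≤ c → M (c • f) = c • M f
  map_add_const : ∀ (f : X → ℝ) (c : ℝ), M (fun x => f x + c) = M f

/-! ### Transition operators: non-expansiveness and stability of iterates. -/

namespace IsTransitionOperator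

variable {X : Type*} {P : (X → ℝ) → (X → ℝ)}

theorem map_zero (hP : IsTransitionOperator P) : P 0 = 0 := by
  simpa using hP.map_smul 0 0 le_rfl

theorem iterate (hP : IsTransitionOperator P) (n : ℕ) : IsTransitionOperator (P^[n]) := by
  induction n with
  | zero => exact ⟨fun _ _ h => h, fun _ _ _ => rfl, fun _ _ => rfl⟩
  | succ n ih =>
    refine ⟨hP.mono.iterate _, fun c f hc => ?_, fun f c => ?_⟩
    · simp only [Function.iterate_succ_apply', ih.map_smul c f hc, hP.map_smul c _ hc]
    · simp only [Function.iterate_succ_apply', ih.map_add_const f c, hP.map_add_const _ c]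

variable [Fintype X]

/-- Apply `P` to `f ≤ g + ‖f - g‖` and pull the constant out. -/
theorem norm_sub_le (hP : IsTransitionOperator P) (f g : X → ℝ) :
    ‖P f - P g‖ ≤ ‖f - g‖ := by
  have key : ∀ f g : X → ℝ, ∀ x, P f x - P g x ≤ ‖f - g‖ := by
    intro f g x
    have h1 : f ≤ fun x => g x + ‖f - g‖ := by
      intro y
      have h2 := (le_abs_self _).trans (norm_le_pi_norm (f - g) y)
      simp only [Pi.sub_apply] at h2
      show f y ≤ g y + ‖f - g‖
      linarith
    have h2 := hP.mono h1 x
    rw [hP.map_add_const] at h2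
    simp only at h2
    linarith
  rw [pi_norm_le_iff_of_nonneg (norm_nonneg _)]
  intro x
  rw [Real.norm_eq_abs, abs_le, Pi.sub_apply]
  have h1 := key f g x
  have h2 := key g f x
  rw [norm_sub_rev] at h2
  constructor <;> linarith

theorem norm_le (hP : IsTransitionOperator P) (f : X → ℝ) : ‖P f‖ ≤ ‖f‖ := by
  simpa [hP.map_zero] using hP.norm_sub_le f 0

theorem continuous (hP : IsTransitionOperator P) : Continuous P := by
  refine (LipschitzWith.of_dist_le_mul (K := 1) fun f g => ?_).continuous
  simpa [dist_eq_norm] using hP.norm_sub_le f g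

/-- Iterates of two transition operators that differ by at most `c` on unit vectors differ
by at most `n * c`. -/
theorem norm_iterate_sub_iterate_le {R : (X → ℝ) → (X → ℝ)} (hP : IsTransitionOperator P)
    (hR : IsTransitionOperator R) {c : ℝ} (hc : 0 ≤ c) (h : ∀ f, ‖P f - R f‖ ≤ c * ‖f‖)
    (n : ℕ) (f : X → ℝ) : ‖P^[n] f - R^[n] f‖ ≤ n * (c * ‖f‖) := by
  induction n with
  | zero => simp
  | succ n ih =>
    rw [Function.iterate_succ_apply', Function.iterate_succ_apply']
    have h1 := h (P^[n] f)
    have h2 := hR.norm_sub_le (P^[n] f) (R^[n] f)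
    have h3 := norm_sub_le_norm_sub_add_norm_sub (P (P^[n] f)) (R (P^[n] f)) (R (R^[n] f))
    have h4 := mul_le_mul_of_nonneg_left ((hP.iterate n).norm_le f) hc
    push_cast
    linarith

end IsTransitionOperator

/-! ### Rate operators: Euler steps and the operator exponential. -/

namespace IsRateOperator

variable {X : Type*} {M : (X → ℝ) → (X → ℝ)} {L : ℝ}

theorem map_zero (hM : IsRateOperator M L) : M 0 = 0 := by
  simpa using hM.map_smul 0 0 le_rfl

/-- One Euler step of small size is a transition operator. -/
theorem isTransitionOperator (hM : IsRateOperator M L) {s : ℝ} (hs : 0 ≤ s)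
    (hsL : s * L ≤ 1) : IsTransitionOperator (fun f => f + s • M f) := by
  refine ⟨fun f g h x => ?_, fun c f hc => ?_, fun f c => ?_⟩
  · have h1 := mul_le_mul_of_nonneg_left (hM.mono f g h x) hs
    have h2 := mul_le_mul_of_nonneg_left (h x) (sub_nonneg.2 hsL)
    simp only [Pi.add_apply, Pi.smul_apply, smul_eq_mul]
    linarith
  · simp only [hM.map_smul c f hc, smul_add, smul_comm c s]
  · funext x
    simp only [hM.map_add_const, Pi.add_apply, Pi.smul_apply]
    ring

theorem eventually_div_mul_le_one (L t : ℝ) : ∀ᶠ n : ℕ in atTop, 0 < n ∧ t / n * L ≤ 1 := by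
  obtain ⟨N, hN⟩ := exists_nat_ge (t * L)
  filter_upwards [eventually_ge_atTop N, eventually_gt_atTop 0] with n hn hn0
  refine ⟨hn0, ?_⟩
  have h : (0 : ℝ) < n := by exact_mod_cast hn0
  rw [div_mul_eq_mul_div, div_le_one h]
  exact hN.trans (by exact_mod_cast hn)

theorem eventually_isTransitionOperator_expApprox (hM : IsRateOperator M L) {t : ℝ}
    (ht : 0 ≤ t) : ∀ᶠ n : ℕ in atTop, IsTransitionOperator (expApprox M t n) := by
  filter_upwards [eventually_div_mul_le_one L t] with n hn
  exact (hM.isTransitionOperator (by positivity) hn.2).iterate n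

variable [Fintype X]

theorem norm_sub_le (hM : IsRateOperator M L) (f g : X → ℝ) :
    ‖M f - M g‖ ≤ 2 * L * ‖f - g‖ := by
  have key : ∀ f g : X → ℝ, ∀ x, M f x - M g x ≤ 2 * L * ‖f - g‖ := by
    intro f g x
    have h0 : ∀ y, |f y - g y| ≤ ‖f - g‖ := fun y => norm_le_pi_norm (f - g) y
    have h1 : f ≤ fun x => g x + ‖f - g‖ := by
      intro y
      have := (le_abs_self _).trans (h0 y)
      show f y ≤ g y + ‖f - g‖
      linarith
    have h2 := hM.mono _ _ h1 x
    rw [hM.map_add_const] at h2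
    have h3 := mul_le_mul_of_nonneg_left ((neg_le_abs _).trans (h0 x)) hM.nonneg
    linarith
  rw [pi_norm_le_iff_of_nonneg (by have := hM.nonneg; positivity)]
  intro x
  rw [Real.norm_eq_abs, abs_le, Pi.sub_apply]
  have h1 := key f g x
  have h2 := key g f x
  rw [norm_sub_rev] at h2
  constructor <;> linarith

theorem norm_le (hM : IsRateOperator M L) (f : X → ℝ) : ‖M f‖ ≤ 2 * L * ‖f‖ := by
  simpa [hM.map_zero] using hM.norm_sub_le f 0

/-- Second order error of several Euler steps against a single one. -/
theorem norm_iterate_sub_le (hM : IsRateOperator M L) {s : ℝ} (hs : 0 ≤ s)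
    (hsL : s * L ≤ 1) (m : ℕ) (f : X → ℝ) :
    ‖(fun g => g + s • M g)^[m] f - (f + (m * s) • M f)‖ ≤
      4 * L ^ 2 * (m * s) ^ 2 * ‖f‖ := by
  have hP := hM.isTransitionOperator hs hsL
  have hL := hM.nonneg
  -- The iterates stay within `k s · 2L‖f‖` of `f`, so step `k` adds an error of at most `4L² k s²
  -- ‖f‖`; the sum over `k < m` is bounded using `∑ k ≤ m²`.
  have hdist : ∀ k : ℕ, ‖(fun g => g + s • M g)^[k] f - f‖ ≤ k * (s * (2 * L * ‖f‖)) := by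
    intro k
    induction k with
    | zero => simp
    | succ k ih =>
      rw [Function.iterate_succ_apply']
      set u := (fun g => g + s • M g)^[k] f
      have hu : ‖u‖ ≤ ‖f‖ := (hP.iterate k).norm_le f
      have h1 : ‖s • M u‖ ≤ s * (2 * L * ‖f‖) := by
        rw [norm_smul, Real.norm_of_nonneg hs]
        exact mul_le_mul_of_nonneg_left
          ((hM.norm_le u).trans (mul_le_mul_of_nonneg_left hu (by positivity))) hs
      have h2 : u + s • M u - f = (u - f) + s • M u := by abel
      have h3 := norm_add_le (u - f) (s • M u)
      simp only [h2]
      push_cast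
      linarith
  induction m with
  | zero => simp
  | succ k ih =>
    rw [Function.iterate_succ_apply']
    have hd := hdist k
    set u := (fun g => g + s • M g)^[k] f
    have h1 : ‖s • (M u - M f)‖ ≤ s * (2 * L * (k * (s * (2 * L * ‖f‖)))) := by
      rw [norm_smul, Real.norm_of_nonneg hs]
      exact mul_le_mul_of_nonneg_left
        ((hM.norm_sub_le u f).trans (mul_le_mul_of_nonneg_left hd (by positivity))) hs
    have h2 : u + s • M u - (f + ((k + 1 : ℕ) * s) • M f) =
        (u - (f + (k * s) • M f)) + s • (M u - M f) := by
      push_cast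
      module
    have h3 := norm_add_le (u - (f + (k * s) • M f)) (s • (M u - M f))
    have h4 : 0 ≤ L ^ 2 * s ^ 2 * ‖f‖ := by positivity
    have h5 : 0 ≤ (k : ℝ) * (L ^ 2 * s ^ 2 * ‖f‖) := by positivity
    simp only [h2]
    push_cast
    nlinarith

/-- Group the fine steps into `n` blocks of `m`: each block differs from one coarse step by a second
order error, and the `n` errors add up without amplification. -/
theorem norm_expApprox_sub_expApprox_mul_le (hM : IsRateOperator M L) {t : ℝ} (ht : 0 ≤ t)
    {n m : ℕ} (hn : 0 < n) (hm : 0 < m) (hnL : t / n * L ≤ 1) (f : X → ℝ) :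
    ‖expApprox M t n f - expApprox M t (m * n) f‖ ≤ 4 * L ^ 2 * t ^ 2 * ‖f‖ / n := by
  have hL := hM.nonneg
  have hn' : (0 : ℝ) < n := by exact_mod_cast hn
  have hm' : (1 : ℝ) ≤ m := by exact_mod_cast hm
  have hs : 0 ≤ t / n := by positivity
  have hs' : 0 ≤ t / (m * n : ℕ) := by positivity
  have hms : (m : ℝ) * (t / (m * n : ℕ)) = t / n := by
    push_cast
    field_simp
  have hsL' : t / (m * n : ℕ) * L ≤ 1 := by
    refine (mul_le_mul_of_nonneg_right ?_ hL).trans hnL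
    rw [← hms]
    exact le_mul_of_one_le_left hs' hm'
  have key := (hM.isTransitionOperator hs hnL).norm_iterate_sub_iterate_le
    ((hM.isTransitionOperator hs' hsL').iterate m) (c := 4 * L ^ 2 * (t / n) ^ 2)
    (by positivity) (fun g => by
      have h := hM.norm_iterate_sub_le hs' hsL' m g
      rw [hms, norm_sub_rev] at h
      exact h) n f
  rw [← Function.iterate_mul] at key
  refine key.trans (le_of_eq ?_)
  field_simp

/-- Cauchy property: `n` and `m` steps are compared through the common refinement into `n * m`
steps. -/
theorem tendsto_expApprox (hM : IsRateOperator M L) {t : ℝ} (ht : 0 ≤ t) (f : X → ℝ) :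
    Tendsto (fun n : ℕ => expApprox M t n f) atTop (𝓝 (opExp M t f)) := by
  refine CauchySeq.tendsto_limUnder (Metric.cauchySeq_iff.2 fun ε hε => ?_)
  set C := 4 * L ^ 2 * t ^ 2 * ‖f‖
  have hC : Tendsto (fun n : ℕ => C / n) atTop (𝓝 0) := tendsto_const_div_atTop_nhds_zero_nat C
  obtain ⟨N, hN⟩ := eventually_atTop.1
    ((hC.eventually (gt_mem_nhds (half_pos hε))).and (eventually_div_mul_le_one L t))
  refine ⟨N, fun m hm n hn => ?_⟩
  obtain ⟨hm1, hm2, hm3⟩ := hN m hm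
  obtain ⟨hn1, hn2, hn3⟩ := hN n hn
  have h1 := hM.norm_expApprox_sub_expApprox_mul_le ht hm2 hn2 hm3 f
  have h2 := hM.norm_expApprox_sub_expApprox_mul_le ht hn2 hm2 hn3 f
  rw [mul_comm m n, norm_sub_rev] at h2
  have h3 := norm_sub_le_norm_sub_add_norm_sub (expApprox M t m f)
    (expApprox M t (n * m) f) (expApprox M t n f)
  rw [dist_eq_norm]
  linarith

theorem isTransitionOperator_opExp (hM : IsRateOperator M L) {t : ℝ} (ht : 0 ≤ t) :
    IsTransitionOperator (opExp M t) := by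
  have hev := hM.eventually_isTransitionOperator_expApprox ht
  refine ⟨fun f g h => ?_, fun c f hc => ?_, fun f c => ?_⟩
  · exact le_of_tendsto_of_tendsto (hM.tendsto_expApprox ht f) (hM.tendsto_expApprox ht g)
      (hev.mono fun n hn => hn.mono h)
  · refine tendsto_nhds_unique_of_eventuallyEq (hM.tendsto_expApprox ht _)
      ((hM.tendsto_expApprox ht f).const_smul c) (hev.mono fun n hn => hn.map_smul c f hc)
  · refine tendsto_nhds_unique_of_eventuallyEq (hM.tendsto_expApprox ht _)
      ((hM.tendsto_expApprox ht f).add_const (fun _ => c))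
      (hev.mono fun n hn => hn.map_add_const f c)

/-- The Euler error bound depends only on the total time, so it survives the limit. -/
theorem norm_opExp_sub_le (hM : IsRateOperator M L) {t : ℝ} (ht : 0 ≤ t) (f : X → ℝ) :
    ‖opExp M t f - (f + t • M f)‖ ≤ 4 * L ^ 2 * t ^ 2 * ‖f‖ := by
  refine le_of_tendsto ((hM.tendsto_expApprox ht f).sub_const _).norm ?_
  filter_upwards [eventually_div_mul_le_one L t] with n hn
  have hn' : (n : ℝ) ≠ 0 := by exact_mod_cast hn.1.ne'
  have h := hM.norm_iterate_sub_le (by positivity) hn.2 n f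
  rwa [mul_div_cancel₀ _ hn'] at h

/-- Pointwise ordered rate operators have ordered exponentials. -/
theorem opExp_le_opExp {M' : (X → ℝ) → (X → ℝ)} {L' : ℝ} (hM : IsRateOperator M L)
    (hM' : IsRateOperator M' L') (h : M ≤ M') {t : ℝ} (ht : 0 ≤ t) : opExp M t ≤ opExp M' t := by
  intro f
  refine le_of_tendsto_of_tendsto (hM.tendsto_expApprox ht f) (hM'.tendsto_expApprox ht f) ?_
  filter_upwards [eventually_div_mul_le_one L t] with n hn
  have hP := hM.isTransitionOperator (s := t / n) (by positivity) hn.2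
  refine hP.mono.iterate_le_of_le (fun g => ?_) n f
  exact add_le_add_right (smul_le_smul_of_nonneg_left (h g) (by positivity)) g

end IsRateOperator

/-! ### Hitting times: comparison, existence and convergence. -/

/-- One step of the fixed point iteration for the expected hitting times of `A`, for a step of
length `Δ` with transition operator `P`. -/
noncomputable def hitStep {X : Type*} (A : Set X) (Δ : ℝ) (P : (X → ℝ) → (X → ℝ))
    (h : X → ℝ) : X → ℝ :=
  Δ • Aᶜ.indicator 1 + Aᶜ.indicator 1 * P h

/-- The non-negative functions `h` that vanish on `A` and satisfy `M h = -1` off `A`. -/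
def hittingSolutions {X : Type*} (A : Set X) (M : (X → ℝ) → (X → ℝ)) : Set (X → ℝ) :=
  {h | 0 ≤ h ∧ A.indicator 1 * h = Aᶜ.indicator 1 + Aᶜ.indicator 1 * M h}

section HittingTimes

variable {X : Type*} {A : Set X} {Δ : ℝ} {P : (X → ℝ) → (X → ℝ)}

theorem hitStep_of_mem {x : X} (hx : x ∈ A) (h : X → ℝ) : hitStep A Δ P h x = 0 := by
  simp [hitStep, hx]

theorem hitStep_of_notMem {x : X} (hx : x ∉ A) (h : X → ℝ) :
    hitStep A Δ P h x = Δ + P h x := by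
  simp [hitStep, hx]

theorem hitStep_mono (hP : Monotone P) : Monotone (hitStep A Δ P) := by
  intro f g h x
  by_cases hx : x ∈ A
  · simp [hitStep_of_mem hx]
  · simpa [hitStep_of_notMem hx] using hP h x

theorem hitStep_le_hitStep {R : (X → ℝ) → (X → ℝ)} (h : P ≤ R) :
    hitStep A Δ P ≤ hitStep A Δ R := by
  intro f x
  by_cases hx : x ∈ A
  · simp [hitStep_of_mem hx]
  · simpa [hitStep_of_notMem hx] using h f x

theorem IsTransitionOperator.hitStep_nonneg (hP : IsTransitionOperator P) (hΔ : 0 ≤ Δ)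
    {h : X → ℝ} (h0 : 0 ≤ h) : 0 ≤ hitStep A Δ P h := by
  intro x
  have h1 := hP.mono h0 x
  rw [hP.map_zero] at h1
  by_cases hx : x ∈ A
  · simp [hitStep_of_mem hx]
  · rw [hitStep_of_notMem hx]
    exact add_nonneg hΔ h1

theorem mem_discreteSolutions {h : X → ℝ} :
    h ∈ discreteSolutions A Δ P ↔ 0 ≤ h ∧ h = hitStep A Δ P h := Iff.rfl

/-- Comparison principle: subsolutions lie below non-negative supersolutions. -/
theorem IsTransitionOperator.le_of_hitStep [Finite X] (hP : IsTransitionOperator P)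
    (hΔ : 0 < Δ) {w h : X → ℝ} (hw : w ≤ hitStep A Δ P w) (h0 : 0 ≤ h)
    (hh : hitStep A Δ P h ≤ h) : w ≤ h := by
  by_contra hcon
  obtain ⟨x, hx⟩ : ∃ x, h x < w x := by
    simpa [Pi.le_def] using hcon
  have hwA : ∀ y ∈ A, w y ≤ 0 := fun y hy => (hw y).trans (hitStep_of_mem hy w).le
  have hhA : ∀ y ∉ A, Δ + P h y ≤ h y := fun y hy => by
    simpa [hitStep_of_notMem hy] using hh y
  have hPh : ∀ y, 0 ≤ P h y := fun y => by
    simpa [hP.map_zero] using hP.mono h0 y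
  have hpos : ∀ y ∉ A, 0 < h y := fun y hy => by linarith [hhA y hy, hPh y]
  have hxA : x ∉ A := fun hxA => by
    have := h0 x
    simp only [Pi.zero_apply] at this
    linarith [hwA x hxA]
  have : Nonempty X := ⟨x⟩
  -- Scale `h` until it touches `w` from above. Points of `A` give quotients `≤ 0`, also when `h y =
  -- 0`, so the maximum, which exceeds `1`, is off `A`. There `w z ≤ Δ + μ (h z - Δ) < μ h z = w z`.
  obtain ⟨z, hz⟩ := Finite.exists_max fun y => w y / h y
  set μ := w z / h z with hμ
  have hμ1 : 1 < μ := ((one_lt_div (hpos x hxA)).2 hx).trans_le (hz x)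
  have hzA : z ∉ A := fun hzA => by
    have := div_nonpos_of_nonpos_of_nonneg (hwA z hzA) (h0 z)
    linarith
  have hle : w ≤ μ • h := by
    intro y
    simp only [Pi.smul_apply, smul_eq_mul]
    by_cases hy : y ∈ A
    · exact (hwA y hy).trans (mul_nonneg (by linarith) (h0 y))
    · exact (div_le_iff₀ (hpos y hy)).1 (hz y)
  have h1 := hP.mono hle z
  rw [hP.map_smul μ h (by linarith)] at h1
  simp only [Pi.smul_apply, smul_eq_mul] at h1
  have h2 : w z ≤ Δ + P w z := by simpa [hitStep_of_notMem hzA] using hw z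
  have h3 : w z = μ * h z := (div_mul_cancel₀ _ (hpos z hzA).ne').symm
  have h4 := hhA z hzA
  nlinarith

/-- Comparison makes the solution unique, so minimality is automatic. -/
theorem IsTransitionOperator.isLeast_discreteSolutions [Finite X]
    (hP : IsTransitionOperator P) (hΔ : 0 < Δ) {h : X → ℝ}
    (hh : h ∈ discreteSolutions A Δ P) : IsLeast (discreteSolutions A Δ P) h :=
  ⟨hh, fun _ hg => hP.le_of_hitStep hΔ hh.2.le hg.1 hg.2.ge⟩

/-- If the iterates of `hitStep` started in zero are bounded, then they increase to a
solution. -/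
theorem IsTransitionOperator.exists_mem_discreteSolutions [Fintype X]
    (hP : IsTransitionOperator P) (hΔ : 0 ≤ Δ) {B : X → ℝ}
    (hB : ∀ k, (hitStep A Δ P)^[k] 0 ≤ B) : (discreteSolutions A Δ P).Nonempty := by
  have hmono : Monotone fun k => (hitStep A Δ P)^[k] 0 :=
    (hitStep_mono hP.mono).monotone_iterate_of_le_map (hP.hitStep_nonneg hΔ le_rfl)
  set h : X → ℝ := fun x => ⨆ k, (hitStep A Δ P)^[k] 0 x with h_def
  have hlim : Tendsto (fun k => (hitStep A Δ P)^[k] 0) atTop (𝓝 h) :=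
    tendsto_pi_nhds.2 fun x => tendsto_atTop_ciSup (fun _ _ hij => hmono hij x)
      ⟨B x, by rintro _ ⟨k, rfl⟩; exact hB k x⟩
  have hcont : Continuous (hitStep A Δ P) := by
    have := hP.continuous
    unfold hitStep
    fun_prop
  refine ⟨h, ge_of_tendsto' hlim fun k => hmono (Nat.zero_le k), ?_⟩
  refine tendsto_nhds_unique ((tendsto_add_atTop_iff_nat 1).2 hlim) ?_
  simp only [Function.iterate_succ_apply']
  exact (hcont.tendsto h).comp hlim

/-- If `n` steps leave `Aᶜ` with positive probability from every state, then the iterates of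
`hitStep` started in zero are bounded. -/
theorem IsTransitionOperator.exists_hitStep_iterate_le [Finite X]
    (hP : IsTransitionOperator P) (hΔ : 0 ≤ Δ) {n : ℕ} (hn : 0 < n)
    (h : ∀ x ∈ Aᶜ, P^[n] (Aᶜ.indicator 1) x < 1) :
    ∃ B : X → ℝ, ∀ k, (hitStep A Δ P)^[k] 0 ≤ B := by
  -- For `C` above these quotients, `C p + n Δ ≤ C` off `A`, where `p` is the mass remaining after
  -- `n` steps. So `C 1_{Aᶜ}` is a supersolution for `n` steps and dominates all iterates.
  obtain ⟨K, hK⟩ := (Set.finite_range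
    fun x => n * Δ / (1 - P^[n] (Aᶜ.indicator 1) x)).bddAbove
  obtain ⟨C, hC0, hKC⟩ : ∃ C : ℝ, 0 ≤ C ∧ K ≤ C := ⟨max K 0, le_max_right _ _, le_max_left _ _⟩
  have hT : Monotone (hitStep A Δ P) := hitStep_mono hP.mono
  have hnonneg : ∀ f : X → ℝ, 0 ≤ f → ∀ k, 0 ≤ (hitStep A Δ P)^[k] f := by
    intro f hf k
    induction k with
    | zero => exact hf
    | succ k ih =>
      rw [Function.iterate_succ_apply']
      exact hP.hitStep_nonneg hΔ ih
  have hiter : ∀ f : X → ℝ, 0 ≤ f → ∀ k x,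
      (hitStep A Δ P)^[k] f x ≤ P^[k] f x + k * Δ := by
    intro f hf k
    induction k with
    | zero => simp
    | succ k ih =>
      intro x
      have h1 := hP.mono (show (hitStep A Δ P)^[k] f ≤ fun x => P^[k] f x + k * Δ from ih) x
      have h2 := hP.mono (hnonneg f hf k) x
      rw [hP.map_add_const] at h1
      rw [hP.map_zero] at h2
      simp only [Pi.zero_apply] at h1 h2
      rw [Function.iterate_succ_apply', Function.iterate_succ_apply']
      push_cast
      by_cases hx : x ∈ A
      · rw [hitStep_of_mem hx]
        linarith
      · rw [hitStep_of_notMem hx]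
        linarith
  set w : X → ℝ := C • Aᶜ.indicator 1 with w_def
  have hw0 : 0 ≤ w := smul_nonneg hC0 (Set.indicator_nonneg fun _ _ => zero_le_one)
  have hw : (hitStep A Δ P)^[n] w ≤ w := by
    intro x
    by_cases hx : x ∈ A
    · obtain ⟨m, rfl⟩ := Nat.exists_eq_succ_of_ne_zero hn.ne'
      rw [Function.iterate_succ_apply', hitStep_of_mem hx]
      exact hw0 x
    · refine (hiter w hw0 n x).trans ?_
      rw [w_def, (hP.iterate n).map_smul C _ hC0]
      have h1 : 0 < 1 - P^[n] (Aᶜ.indicator 1) x := sub_pos.2 (h x hx)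
      have h2 := (div_le_iff₀ h1).1 ((hK ⟨x, rfl⟩).trans hKC)
      simp only [Pi.smul_apply, smul_eq_mul, Set.indicator_of_mem (Set.mem_compl hx),
        Pi.one_apply]
      linarith
  have hwk : ∀ k, ((hitStep A Δ P)^[n])^[k] w ≤ w := by
    intro k
    induction k with
    | zero => exact le_rfl
    | succ k ih =>
      rw [Function.iterate_succ_apply']
      exact ((hT.iterate n) ih).trans hw
  have hmono : Monotone fun k => (hitStep A Δ P)^[k] 0 :=
    hT.monotone_iterate_of_le_map (hP.hitStep_nonneg hΔ le_rfl)
  refine ⟨w, fun k => (hmono (Nat.le_mul_of_pos_left k hn)).trans ?_⟩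
  simp only [Function.iterate_mul]
  exact (((hT.iterate n).iterate k) hw0).trans (hwk k)

theorem hitStep_iterate_le {R : (X → ℝ) → (X → ℝ)} (hP : Monotone P) (h : P ≤ R) (k : ℕ) :
    (hitStep A Δ P)^[k] 0 ≤ (hitStep A Δ R)^[k] 0 :=
  (hitStep_mono hP).iterate_le_of_le (hitStep_le_hitStep h) k 0

variable {M : (X → ℝ) → (X → ℝ)} {L : ℝ}

theorem mem_hittingSolutions {h : X → ℝ} :
    h ∈ hittingSolutions A M ↔ 0 ≤ h ∧ (∀ x ∈ A, h x = 0) ∧ ∀ x ∉ A, M h x = -1 := by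
  refine and_congr_right fun _ => ⟨fun e => ⟨fun x hx => ?_, fun x hx => ?_⟩, fun e => ?_⟩
  · simpa [hx] using congrFun e x
  · have := congrFun e x
    simp [hx] at this
    linarith
  · funext x
    by_cases hx : x ∈ A
    · simp [hx, e.1 x hx]
    · simp [hx, e.2 x hx]

/-- The hitting times of a rate operator are the hitting times of its Euler steps. -/
theorem discreteSolutions_eulerStep {s : ℝ} (hs : s ≠ 0) :
    discreteSolutions A s (fun f => f + s • M f) = hittingSolutions A M := by
  ext h
  rw [mem_discreteSolutions, mem_hittingSolutions]
  refine and_congr_right fun _ => ⟨fun e => ⟨fun x hx => ?_, fun x hx => ?_⟩, fun e => ?_⟩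
  · rw [e, hitStep_of_mem hx]
  · have h1 := congrFun e x
    rw [hitStep_of_notMem hx] at h1
    simp only [Pi.add_apply, Pi.smul_apply, smul_eq_mul] at h1
    exact mul_left_cancel₀ hs (by linarith)
  · funext x
    by_cases hx : x ∈ A
    · rw [hitStep_of_mem hx, e.1 x hx]
    · simp [hitStep_of_notMem hx, e.2 x hx]

namespace IsRateOperator

theorem exists_pos_mul_le_one (hM : IsRateOperator M L) : ∃ s : ℝ, 0 < s ∧ s * L ≤ 1 := by
  have hL := hM.nonneg
  refine ⟨1 / (L + 1), by positivity, ?_⟩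
  rw [div_mul_eq_mul_div, one_mul, div_le_one (by positivity)]
  linarith

/-- Comparison principle for rate operators. -/
theorem le_of_hittingSolutions [Finite X] {M' : (X → ℝ) → (X → ℝ)}
    (hM' : IsRateOperator M' L) (h : M ≤ M') {g g' : X → ℝ}
    (hg : g ∈ hittingSolutions A M) (hg' : g' ∈ hittingSolutions A M') : g ≤ g' := by
  obtain ⟨s, hs, hsL⟩ := hM'.exists_pos_mul_le_one
  have hle : (fun f => f + s • M f) ≤ fun f => f + s • M' f := fun f =>
    add_le_add_right (smul_le_smul_of_nonneg_left (h f) hs.le) f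
  rw [← discreteSolutions_eulerStep hs.ne'] at hg hg'
  refine (hM'.isTransitionOperator hs.le hsL).le_of_hitStep hs ?_ hg'.1 hg'.2.ge
  exact hg.2.le.trans (hitStep_le_hitStep hle g)

theorem isLeast_hittingSolutions [Finite X] (hM : IsRateOperator M L) {g : X → ℝ}
    (hg : g ∈ hittingSolutions A M) : IsLeast (hittingSolutions A M) g :=
  ⟨hg, fun _ hf => hM.le_of_hittingSolutions le_rfl hg hf⟩

/-- The hitting times in discrete time converge to those in continuous time. -/
theorem tendsto_hittingTimes [Fintype X] (hM : IsRateOperator M L) {g : X → ℝ}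
    (hg : g ∈ hittingSolutions A M) {H : ℝ → X → ℝ}
    (hH : ∀ Δ, 0 < Δ → H Δ ∈ discreteSolutions A Δ (opExp M Δ)) :
    Tendsto H (𝓝[>] 0) (𝓝 g) := by
  obtain ⟨hg0, hgA, hgM⟩ := mem_hittingSolutions.1 hg
  set C := 4 * L ^ 2 * ‖g‖ with hC
  have hC0 : 0 ≤ C := by positivity
  have herr : ∀ Δ, 0 < Δ → ∀ x ∉ A, |opExp M Δ g x - (g x - Δ)| ≤ C * Δ ^ 2 := by
    intro Δ hΔ x hx
    have h1 := (norm_le_pi_norm _ x).trans (hM.norm_opExp_sub_le hΔ.le g)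
    simp only [Pi.sub_apply, Pi.add_apply, Pi.smul_apply, smul_eq_mul, hgM x hx,
      Real.norm_eq_abs] at h1
    rw [show g x - Δ = g x + Δ * -1 by ring]
    refine h1.trans (le_of_eq ?_)
    rw [hC]
    ring
  have hsmall : ∀ᶠ Δ : ℝ in 𝓝[>] 0, 0 < Δ ∧ 2 * C * Δ < 1 := by
    refine eventually_mem_nhdsWithin.and (mem_nhdsWithin_of_mem_nhds ?_)
    have : Tendsto (fun Δ : ℝ => 2 * C * Δ) (𝓝 0) (𝓝 0) :=
      (continuous_const.mul continuous_id).tendsto' _ _ (by simp)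
    exact this.eventually (gt_mem_nhds one_pos)
  have hscale : ∀ a : ℝ, Tendsto (fun Δ : ℝ => (1 + a * Δ) • g) (𝓝[>] 0) (𝓝 g) := by
    intro a
    have : Continuous fun Δ : ℝ => (1 + a * Δ) • g := by fun_prop
    exact (this.tendsto' 0 g (by simp)).mono_left nhdsWithin_le_nhds
  have hlow : ∀ᶠ Δ : ℝ in 𝓝[>] 0, (1 + -C * Δ) • g ≤ H Δ := by
    filter_upwards [hsmall] with Δ ⟨hΔ, hCΔ⟩
    have hP := hM.isTransitionOperator_opExp hΔ.le
    refine hP.le_of_hitStep hΔ (fun x => ?_) (hH Δ hΔ).1 (hH Δ hΔ).2.ge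
    have hCΔ0 : 0 ≤ C * Δ := by positivity
    have hc : 0 ≤ 1 + -C * Δ := by linarith
    by_cases hx : x ∈ A
    · simp [hitStep_of_mem hx, hgA x hx]
    · rw [hitStep_of_notMem hx, hP.map_smul _ _ hc]
      simp only [Pi.smul_apply, smul_eq_mul]
      have h1 := mul_le_mul_of_nonneg_left (abs_le.1 (herr Δ hΔ x hx)).1 hc
      have h2 : 0 ≤ C * Δ * (C * Δ) * Δ := by positivity
      nlinarith
  -- The factor `2` absorbs the cross term: the slack left is `CΔ² (1 - 2CΔ) ≥ 0`.
  have hup : ∀ᶠ Δ : ℝ in 𝓝[>] 0, H Δ ≤ (1 + 2 * C * Δ) • g := by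
    filter_upwards [hsmall] with Δ ⟨hΔ, hCΔ⟩
    have hP := hM.isTransitionOperator_opExp hΔ.le
    have hc : 0 ≤ 1 + 2 * C * Δ := by positivity
    refine hP.le_of_hitStep hΔ (hH Δ hΔ).2.le (smul_nonneg hc hg0) (fun x => ?_)
    by_cases hx : x ∈ A
    · simp [hitStep_of_mem hx, hgA x hx]
    · rw [hitStep_of_notMem hx, hP.map_smul _ _ hc]
      simp only [Pi.smul_apply, smul_eq_mul]
      have h1 := mul_le_mul_of_nonneg_left (abs_le.1 (herr Δ hΔ x hx)).2 hc
      have h2 : 0 ≤ C * Δ ^ 2 * (1 - 2 * C * Δ) :=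
        mul_nonneg (by positivity) (by linarith)
      nlinarith
  exact tendsto_pi_nhds.2 fun x => tendsto_of_tendsto_of_tendsto_of_le_of_le'
    (tendsto_pi_nhds.1 (hscale (-C)) x) (tendsto_pi_nhds.1 (hscale (2 * C)) x)
    (hlow.mono fun _ h => h x) (hup.mono fun _ h => h x)

end IsRateOperator

end HittingTimes

/-! ### Rate matrices and their lower and upper envelopes. -/

section RateMatrices

variable {X : Type*} {𝒬 : Set (Matrix X X ℝ)} {L : ℝ}

/-- A pointwise minimum of rate operators is a rate operator. -/
theorem isRateOperator_of_exists_min {M : (X → ℝ) → (X → ℝ)} {S : Set ((X → ℝ) → (X → ℝ))}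
    (hL : 0 ≤ L) (hS : ∀ N ∈ S, IsRateOperator N L)
    (h : ∀ f, ∃ N ∈ S, M f = N f ∧ ∀ N' ∈ S, M f ≤ N' f) : IsRateOperator M L := by
  refine ⟨hL, fun f g hfg x => ?_, fun c f hc => ?_, fun f c => ?_⟩
  · obtain ⟨N, hN, h1, -⟩ := h g
    obtain ⟨-, -, -, h2⟩ := h f
    rw [h1]
    linarith [(hS N hN).mono f g hfg x, h2 N hN x]
  · obtain ⟨N, hN, h1, h1'⟩ := h f
    obtain ⟨N', hN', h2, h2'⟩ := h (c • f)
    refine le_antisymm ?_ ?_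
    · rw [h1, ← (hS N hN).map_smul c f hc]
      exact h2' N hN
    · rw [h2, (hS N' hN').map_smul c f hc]
      exact smul_le_smul_of_nonneg_left (h1' N' hN') hc
  · obtain ⟨N, hN, h1, h1'⟩ := h f
    obtain ⟨N', hN', h2, h2'⟩ := h (fun x => f x + c)
    refine le_antisymm ?_ ?_
    · rw [h1, ← (hS N hN).map_add_const f c]
      exact h2' N hN
    · rw [h2, (hS N' hN').map_add_const f c]
      exact h1' N' hN'

/-- The dual of a rate operator is a rate operator. -/
theorem IsRateOperator.dual {M : (X → ℝ) → (X → ℝ)} (hM : IsRateOperator M L) :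
    IsRateOperator (fun f => -M (-f)) L := by
  refine ⟨hM.nonneg, fun f g hfg x => ?_, fun c f hc => ?_, fun f c => ?_⟩
  · have := hM.mono _ _ (neg_le_neg hfg) x
    simp only [Pi.neg_apply] at this ⊢
    linarith
  · rw [← smul_neg, hM.map_smul c _ hc, smul_neg]
  · rw [← hM.map_add_const (-f) (-c)]
    congr 2
    funext x
    simp only [Pi.neg_apply]
    ring

variable [Fintype X]

theorem IsRateMatrix.isRateOperator {Q : Matrix X X ℝ} (hQ : IsRateMatrix Q) (hL : 0 ≤ L)
    (h : ∀ x, -Q x x ≤ L) : IsRateOperator Q.mulVec L := by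
  classical
  refine ⟨hL, fun f g hfg x => ?_, fun c f _ => Q.mulVec_smul c f, fun f c => ?_⟩
  · have h1 : 0 ≤ ∑ y, (Q x y + if x = y then L else 0) * (g y - f y) := by
      refine Finset.sum_nonneg fun y _ => mul_nonneg ?_ (sub_nonneg.2 (hfg y))
      split_ifs with hxy
      · subst hxy
        linarith [h x]
      · simpa using hQ.1 x y hxy
    simp only [add_mul, Finset.sum_add_distrib, ite_mul, zero_mul, Finset.sum_ite_eq,
      Finset.mem_univ, if_true, mul_sub, Finset.sum_sub_distrib] at h1
    simp only [Matrix.mulVec, dotProduct]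
    linarith
  · funext x
    simp only [Matrix.mulVec, dotProduct, mul_add, Finset.sum_add_distrib, ← Finset.sum_mul,
      hQ.2 x, zero_mul, add_zero]

/-- The lower rate operator is attained, simultaneously in all states. -/
theorem exists_lowerRate_eq (hne : 𝒬.Nonempty) (hcompact : IsCompact 𝒬)
    (hrows : SeparatelySpecifiedRows 𝒬) (f : X → ℝ) :
    ∃ Q ∈ 𝒬, lowerRate 𝒬 f = Q.mulVec f ∧ ∀ R ∈ 𝒬, lowerRate 𝒬 f ≤ R.mulVec f := by
  have hcont : ∀ x, Continuous fun Q : Matrix X X ℝ => Q.mulVec f x := fun x => by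
    simp only [Matrix.mulVec, dotProduct]
    fun_prop
  -- Minimise state by state; `hrows` then glues the minimising rows into one matrix.
  choose R hR hmin using fun x => hcompact.exists_isMinOn hne (hcont x).continuousOn
  have : Nonempty 𝒬 := hne.to_subtype
  have heq : ∀ x, lowerRate 𝒬 f x = (R x).mulVec f x := fun x =>
    le_antisymm
      (ciInf_le (f := fun Q : 𝒬 => (Q : Matrix X X ℝ).mulVec f x)
        ⟨_, by rintro _ ⟨Q, rfl⟩; exact hmin x Q.2⟩ ⟨R x, hR x⟩)
      (le_ciInf fun Q => hmin x Q.2)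
  refine ⟨_, hrows R hR, funext fun x => heq x, fun Q hQ x => ?_⟩
  rw [heq]
  exact hmin x hQ

theorem upperRate_eq_neg (f : X → ℝ) : upperRate 𝒬 f = -lowerRate 𝒬 (-f) := by
  funext x
  simp only [upperRate, lowerRate, Pi.neg_apply, Matrix.mulVec_neg]
  rw [iInf, Real.sInf_def, neg_neg, iSup, ← Set.image_neg_eq_neg, ← Set.range_comp]
  congr 2
  funext Q
  simp

theorem exists_upperRate_eq (hne : 𝒬.Nonempty) (hcompact : IsCompact 𝒬)
    (hrows : SeparatelySpecifiedRows 𝒬) (f : X → ℝ) :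
    ∃ Q ∈ 𝒬, upperRate 𝒬 f = Q.mulVec f ∧ ∀ R ∈ 𝒬, R.mulVec f ≤ upperRate 𝒬 f := by
  obtain ⟨Q, hQ, h1, h2⟩ := exists_lowerRate_eq hne hcompact hrows (-f)
  refine ⟨Q, hQ, by rw [upperRate_eq_neg, h1, Matrix.mulVec_neg, neg_neg], fun R hR => ?_⟩
  rw [upperRate_eq_neg]
  have h3 := h2 R hR
  rw [Matrix.mulVec_neg] at h3
  exact le_neg.2 h3

theorem isRateOperator_lowerRate (hne : 𝒬.Nonempty) (hcompact : IsCompact 𝒬)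
    (hrows : SeparatelySpecifiedRows 𝒬) (hL : 0 ≤ L)
    (h : ∀ Q ∈ 𝒬, IsRateOperator Q.mulVec L) : IsRateOperator (lowerRate 𝒬) L := by
  refine isRateOperator_of_exists_min (S := Matrix.mulVec '' 𝒬) hL
    (Set.forall_mem_image.2 fun Q hQ => h Q hQ) fun f => ?_
  obtain ⟨Q, hQ, h1, h2⟩ := exists_lowerRate_eq hne hcompact hrows f
  exact ⟨_, Set.mem_image_of_mem _ hQ, h1, Set.forall_mem_image.2 fun R hR => h2 R hR⟩

theorem isRateOperator_upperRate (hne : 𝒬.Nonempty) (hcompact : IsCompact 𝒬)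
    (hrows : SeparatelySpecifiedRows 𝒬) (hL : 0 ≤ L)
    (h : ∀ Q ∈ 𝒬, IsRateOperator Q.mulVec L) : IsRateOperator (upperRate 𝒬) L := by
  rw [show upperRate 𝒬 = fun f => -lowerRate 𝒬 (-f) from funext upperRate_eq_neg]
  exact (isRateOperator_lowerRate hne hcompact hrows hL h).dual

theorem exists_isRateOperator (hcompact : IsCompact 𝒬) (hrate : ∀ Q ∈ 𝒬, IsRateMatrix Q) :
    ∃ L : ℝ, ∀ Q ∈ 𝒬, IsRateOperator Q.mulVec L := by
  have hcont : Continuous fun Q : Matrix X X ℝ => ∑ x, |Q x x| := by fun_prop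
  obtain ⟨L, hL⟩ := hcompact.bddAbove_image hcont.continuousOn
  refine ⟨L, fun Q hQ => ?_⟩
  have h1 : ∑ x, |Q x x| ≤ L := hL ⟨Q, hQ, rfl⟩
  refine (hrate Q hQ).isRateOperator
    ((Finset.sum_nonneg fun x _ => abs_nonneg _).trans h1) fun x => ?_
  exact (neg_le_abs _).trans ((Finset.single_le_sum (f := fun x => |Q x x|)
    (fun x _ => abs_nonneg _) (Finset.mem_univ x)).trans h1)

/-- Duality of the Euler approximations of the two exponentials. -/
theorem expApprox_upperRate_indicator_compl (hlow : IsRateOperator (lowerRate 𝒬) L)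
    (A : Set X) (t : ℝ) (n : ℕ) (x : X) :
    expApprox (upperRate 𝒬) t n (Aᶜ.indicator 1) x =
      1 - expApprox (lowerRate 𝒬) t n (A.indicator 1) x := by
  -- The reflection `f ↦ 1 - f` carries a lower Euler step to an upper one and exchanges the two
  -- indicators.
  have hsemi : Function.Semiconj (fun (f : X → ℝ) x => 1 - f x)
      (fun g => g + (t / n) • lowerRate 𝒬 g) (fun g => g + (t / n) • upperRate 𝒬 g) := by
    intro f
    have h1 : lowerRate 𝒬 (-fun x => 1 - f x) = lowerRate 𝒬 f := by
      rw [← hlow.map_add_const f (-1)]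
      congr 1
      funext x
      simp only [Pi.neg_apply]
      ring
    funext x
    simp only [upperRate_eq_neg, h1, Pi.add_apply, Pi.smul_apply, Pi.neg_apply, smul_eq_mul]
    ring
  have h2 : (Aᶜ.indicator 1 : X → ℝ) = fun x => 1 - A.indicator 1 x := by
    funext x
    by_cases hx : x ∈ A <;> simp [hx]
  rw [h2]
  exact (congrFun ((hsemi.iterate_right n) (A.indicator 1)) x).symm

end RateMatrices

/-! ### The main theorem. -/

theorem mainTheorem3 {X : Type*} [Fintype X] [Nontrivial X]
    (A : Set X) (hA : A.Nonempty)
    (𝒬 : Set (Matrix X X ℝ))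
    (hrate : ∀ Q ∈ 𝒬, IsRateMatrix Q)
    (hne : 𝒬.Nonempty) (hcompact : IsCompact 𝒬) (hconvex : Convex ℝ 𝒬)
    (hrows : SeparatelySpecifiedRows 𝒬)
    (habsorbing : ∀ Q ∈ 𝒬, ∀ x ∈ A, Q x x = 0)
    (hreachable : ∀ t : ℝ, 0 < t → ∀ x ∈ Aᶜ,
      0 < opExp (lowerRate 𝒬) t (A.indicator 1) x) :
    -- the limits that define the two exponentials exist
    (∀ t : ℝ, 0 ≤ t → ∀ f : X → ℝ,
      Tendsto (fun n : ℕ => expApprox (lowerRate 𝒬) t n f) atTop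
        (𝓝 (opExp (lowerRate 𝒬) t f)) ∧
      Tendsto (fun n : ℕ => expApprox (upperRate 𝒬) t n f) atTop
        (𝓝 (opExp (upperRate 𝒬) t f))) ∧
    -- the minimal non-negative solutions exist, and they converge as claimed
    ∃ (hLow hUp : ℝ → X → ℝ) (h : Matrix X X ℝ → X → ℝ),
      (∀ Δ : ℝ, 0 < Δ →
        IsLeast (discreteSolutions A Δ (opExp (lowerRate 𝒬) Δ)) (hLow Δ)) ∧
      (∀ Δ : ℝ, 0 < Δ →
        IsLeast (discreteSolutions A Δ (opExp (upperRate 𝒬) Δ)) (hUp Δ)) ∧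
      (∀ Q ∈ 𝒬, IsLeast (continuousSolutions A Q) (h Q)) ∧
      BddAbove (h '' 𝒬) ∧
      Tendsto hLow (𝓝[>] 0) (𝓝 (fun x => ⨅ Q : 𝒬, h Q x)) ∧
      Tendsto hUp (𝓝[>] 0) (𝓝 (fun x => ⨆ Q : 𝒬, h Q x)) := by
  have : Nonempty 𝒬 := hne.to_subtype
  obtain ⟨L, hQ⟩ := exists_isRateOperator hcompact hrate
  have hL : 0 ≤ L := (hQ _ hne.some_mem).nonneg
  have hlow := isRateOperator_lowerRate hne hcompact hrows hL hQ
  have hupp := isRateOperator_upperRate hne hcompact hrows hL hQ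
  have hlowQ : ∀ Q ∈ 𝒬, lowerRate 𝒬 ≤ Q.mulVec := fun Q hQ' f => by
    obtain ⟨-, -, -, h⟩ := exists_lowerRate_eq hne hcompact hrows f
    exact h Q hQ'
  have hQupp : ∀ Q ∈ 𝒬, Q.mulVec ≤ upperRate 𝒬 := fun Q hQ' f => by
    obtain ⟨-, -, -, h⟩ := exists_upperRate_eq hne hcompact hrows f
    exact h Q hQ'
  have hlu : lowerRate 𝒬 ≤ upperRate 𝒬 :=
    (hlowQ _ hne.some_mem).trans (hQupp _ hne.some_mem)
  -- the discrete problems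
  have hdisc : ∀ Δ : ℝ, 0 < Δ →
      (discreteSolutions A Δ (opExp (lowerRate 𝒬) Δ)).Nonempty ∧
      (discreteSolutions A Δ (opExp (upperRate 𝒬) Δ)).Nonempty := by
    intro Δ hΔ
    have hPl := hlow.isTransitionOperator_opExp hΔ.le
    have hPu := hupp.isTransitionOperator_opExp hΔ.le
    have hreach : ∀ x ∈ Aᶜ, opExp (upperRate 𝒬) Δ (Aᶜ.indicator 1) x < 1 := by
      intro x hx
      have h1 := tendsto_pi_nhds.1 (hupp.tendsto_expApprox hΔ.le (Aᶜ.indicator 1)) x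
      have h2 := (tendsto_pi_nhds.1
        (hlow.tendsto_expApprox hΔ.le (A.indicator 1)) x).const_sub 1
      simp only [expApprox_upperRate_indicator_compl hlow] at h1
      rw [tendsto_nhds_unique h1 h2]
      linarith [hreachable Δ hΔ x hx]
    obtain ⟨B, hB⟩ := hPu.exists_hitStep_iterate_le (A := A) hΔ.le one_pos hreach
    exact ⟨hPl.exists_mem_discreteSolutions hΔ.le fun k =>
      (hitStep_iterate_le hPl.mono (hlow.opExp_le_opExp hupp hlu hΔ.le) k).trans (hB k),
      hPu.exists_mem_discreteSolutions hΔ.le hB⟩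
  -- the continuous problems
  have hcont : ∀ M : (X → ℝ) → (X → ℝ), IsRateOperator M L → M ≤ upperRate 𝒬 →
      (hittingSolutions A M).Nonempty := by
    -- Reachability at time `1` passes to the Euler approximations; as `X` is finite, one `n` serves
    -- all states and, through the upper operator, all `M`.
    have hev : ∀ᶠ n : ℕ in atTop, ∀ x : X, x ∈ Aᶜ →
        0 < expApprox (lowerRate 𝒬) 1 n (A.indicator 1) x := by
      refine eventually_all.2 fun x => ?_
      by_cases hx : x ∈ Aᶜ
      · have h1 := tendsto_pi_nhds.1 (hlow.tendsto_expApprox zero_le_one (A.indicator 1)) x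
        filter_upwards [h1.eventually (lt_mem_nhds (hreachable 1 one_pos x hx))] with n hn _
        exact hn
      · exact Eventually.of_forall fun n h => absurd h hx
    obtain ⟨n, hn, hn0, hnL⟩ :=
      (hev.and (IsRateOperator.eventually_div_mul_le_one L 1)).exists
    have hs : (0 : ℝ) < 1 / n := by positivity
    have hPu := hupp.isTransitionOperator hs.le hnL
    obtain ⟨B, hB⟩ := hPu.exists_hitStep_iterate_le (A := A) hs.le hn0 fun x hx => by
      have h1 := expApprox_upperRate_indicator_compl hlow A 1 n x
      have h2 := hn x hx
      unfold expApprox at h1 h2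
      linarith
    intro M hM hMu
    have hP := hM.isTransitionOperator hs.le hnL
    rw [← discreteSolutions_eulerStep hs.ne']
    exact hP.exists_mem_discreteSolutions hs.le fun k => (hitStep_iterate_le hP.mono
      (fun f => add_le_add_right (smul_le_smul_of_nonneg_left (hMu f) hs.le) f) k).trans (hB k)
  obtain ⟨gl, hgl⟩ := hcont _ hlow hlu
  obtain ⟨gu, hgu⟩ := hcont _ hupp le_rfl
  have hex : ∀ Q : Matrix X X ℝ, ∃ g : X → ℝ, Q ∈ 𝒬 → g ∈ hittingSolutions A Q.mulVec := by
    intro Q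
    by_cases h : Q ∈ 𝒬
    · obtain ⟨g, hg⟩ := hcont _ (hQ Q h) (hQupp Q h)
      exact ⟨g, fun _ => hg⟩
    · exact ⟨0, fun h' => absurd h' h⟩
  choose h hh using hex
  have hle : ∀ Q ∈ 𝒬, gl ≤ h Q := fun Q hQ' =>
    (hQ Q hQ').le_of_hittingSolutions (hlowQ Q hQ') hgl (hh Q hQ')
  have hge : ∀ Q ∈ 𝒬, h Q ≤ gu := fun Q hQ' =>
    hupp.le_of_hittingSolutions (hQupp Q hQ') (hh Q hQ') hgu
  -- the infimum and the supremum are attained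
  have hinf : (fun x => ⨅ Q : 𝒬, h Q x) = gl := by
    -- This `Q` is chosen for `gl` itself, so `gl` also solves the linear system of `Q`.
    obtain ⟨Q, hQ', heq, -⟩ := exists_lowerRate_eq hne hcompact hrows gl
    have h1 : gl ∈ hittingSolutions A Q.mulVec := by
      rw [mem_hittingSolutions] at hgl ⊢
      rwa [heq] at hgl
    have h2 : h Q ≤ gl := (hQ Q hQ').le_of_hittingSolutions le_rfl (hh Q hQ') h1
    funext x
    refine le_antisymm ?_ (le_ciInf fun R => hle R R.2 x)
    exact (ciInf_le ⟨gl x, by rintro _ ⟨R, rfl⟩; exact hle R R.2 x⟩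
      (⟨Q, hQ'⟩ : 𝒬)).trans (h2 x)
  have hsup : (fun x => ⨆ Q : 𝒬, h Q x) = gu := by
    obtain ⟨Q, hQ', heq, -⟩ := exists_upperRate_eq hne hcompact hrows gu
    have h1 : gu ∈ hittingSolutions A Q.mulVec := by
      rw [mem_hittingSolutions] at hgu ⊢
      rwa [heq] at hgu
    have h2 : gu ≤ h Q := (hQ Q hQ').le_of_hittingSolutions le_rfl h1 (hh Q hQ')
    funext x
    refine le_antisymm (ciSup_le fun R => hge R R.2 x) ((h2 x).trans ?_)
    exact le_ciSup (f := fun R : 𝒬 => h R x)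
      ⟨gu x, by rintro _ ⟨R, rfl⟩; exact hge R R.2 x⟩ ⟨Q, hQ'⟩
  have hexl : ∀ Δ : ℝ, ∃ g : X → ℝ,
      0 < Δ → g ∈ discreteSolutions A Δ (opExp (lowerRate 𝒬) Δ) := fun Δ => by
    by_cases hΔ : 0 < Δ
    · exact (hdisc Δ hΔ).1.imp fun _ hg _ => hg
    · exact ⟨0, fun h' => absurd h' hΔ⟩
  have hexu : ∀ Δ : ℝ, ∃ g : X → ℝ,
      0 < Δ → g ∈ discreteSolutions A Δ (opExp (upperRate 𝒬) Δ) := fun Δ => by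
    by_cases hΔ : 0 < Δ
    · exact (hdisc Δ hΔ).2.imp fun _ hg _ => hg
    · exact ⟨0, fun h' => absurd h' hΔ⟩
  choose hLow hLow' using hexl
  choose hUp hUp' using hexu
  refine ⟨fun t ht f => ⟨hlow.tendsto_expApprox ht f, hupp.tendsto_expApprox ht f⟩,
    hLow, hUp, h, fun Δ hΔ => ?_, fun Δ hΔ => ?_, fun Q hQ' => ?_, ?_, ?_, ?_⟩
  · exact (hlow.isTransitionOperator_opExp hΔ.le).isLeast_discreteSolutions hΔ (hLow' Δ hΔ)
  · exact (hupp.isTransitionOperator_opExp hΔ.le).isLeast_discreteSolutions hΔ (hUp' Δ hΔ)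
  -- `continuousSolutions A Q` is `hittingSolutions A Q.mulVec` by definition.
  · exact (hQ Q hQ').isLeast_hittingSolutions (hh Q hQ')
  · exact ⟨gu, Set.forall_mem_image.2 fun Q hQ' => hge Q hQ'⟩
  · rw [hinf]
    exact hlow.tendsto_hittingTimes hgl hLow'
  · rw [hsup]
    exact hupp.tendsto_hittingTimes hgu hUp'
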